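/- Let $q$ be a prime power and let $W$ be a $2$-dimensional vector space over $\mathbb F_{q^4}$, so that $\mathrm{PG}(W,\mathbb F_{q^4})=\mathrm{PG}(1,q^4)$. For an $\mathbb F_q$-subspace $U$ of $W$ put $L_U=\{\langle u\rangle_{\mathbb F_{q^4}} : u\in U\setminus\{0\}\}$; if $\dim_{\mathbb F_q}U=k$, then $L_U$ is called an $\mathbb F_q$-linear set of rank $k$ (and linear sets over a subfield $\mathbb F_{q^t}$ of $\mathbb F_{q^4}$ are defined in the same way). The maximum field of linearity of $L_U$ is $\mathbb F_{q^t}$, where $t$ is the largest integer such that $L_U$ is an $\mathbb F_{q^t}$-linear set (of any rank). An $\mathbb F_q$-linear set $L_U$ with maximum field of linearity $\mathbb F_q$ is called simple if every $\mathbb F_q$-subspace $V$ of $W$ with $\dim_{\mathbb F_q}V=\dim_{\mathbb F_q}U$ and $L_V=L_U$ lies in the orbit of $U$ under the group $\Gamma\mathrm L(W,\mathbb F_{q^4})$ of invertible $\mathbb F_{q^4}$-semilinear maps of $W$. **Theorem 4.4.** Every $\mathbb F_q$-linear set $L_U$ of rank $4$ of $\mathrm{PG}(1,q^4)$ whose maximum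 field of linearity is $\mathbb F_q$ is simple. In particular, let $f(x)=\sum_{i=0}^{3}a_ix^{q^i}$ with $a_i\in\mathbb F_{q^4}$, let $\hat f(x)=\sum_{i=0}^{3}a_i^{q^{4-i}}x^{q^{4-i}}$ be its adjoint with respect to the bilinear form $(x,y)\mapsto\mathrm{Tr}_{q^4/q}(xy)$, and put $U_f=\{(x,f(x)) : x\in\mathbb F_{q^4}\}$ and $U_{\hat f}=\{(x,\hat f(x)) : x\in\mathbb F_{q^4}\}$, which are $\mathbb F_q$-subspaces of $\mathbb F_{q^4}^2$. If the maximum field of linearity of $L_{U_f}$ is $\mathbb F_q$, then $U_f$ and $U_{\hat f}$ lie in the same $\Gamma\mathrm L(2,q^4)$-orbit. -/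

import Mathlib

open scoped LinearAlgebra.Projectivization

/-- The point set `L_U = {⟨u⟩_K : u ∈ U ∖ {0}}` of `PG(W, K)` defined by an `E`-subspace `U` of the
`K`-vector space `W` (here `E` is a subfield of `K`). -/
def linearSet {E K W : Type*} [Field E] [Field K] [AddCommGroup W] [Module E W] [Module K W]
    (U : Submodule E W) : Set (ℙ K W) :=
  {P | ∃ (u : W) (hu : u ≠ 0), u ∈ U ∧ P = Projectivization.mk K u hu}

/-- A point set of `PG(W, K)` is `E`-linear, for a subfield `E` of `K`, if it is `L_V` for some
`E`-subspace `V` of `W` (of any rank). -/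
def IsLinearSetOver {F K W : Type*} [Field F] [Field K] [Algebra F K]
    [AddCommGroup W] [Module K W] (E : IntermediateField F K) (L : Set (ℙ K W)) : Prop :=
  ∃ V : Submodule E W, linearSet V = L

/-- With `F = F_q`, the maximum field of linearity of `L` is `F_{q^t}`: here `t` is the largest
integer such that `L` is linear over a subfield of `K` of degree `t` over `F`. -/
def HasMaxLinearityDegree (F : Type*) {K W : Type*} [Field F] [Field K] [Algebra F K]
    [AddCommGroup W] [Module K W] (L : Set (ℙ K W)) (t : ℕ) : Prop :=
  IsGreatest {s : ℕ | ∃ E : IntermediateField F K, Module.finrank F E = s ∧ IsLinearSetOver E L} t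

/-- `U` and `V` lie in the same orbit of the group `ΓL(W, K)` of invertible `K`-semilinear maps
of `W` (with any field automorphism `σ` of `K` as companion). -/
def SameGammaLOrbit {F : Type*} (K : Type*) {W : Type*} [Field F] [Field K]
    [AddCommGroup W] [Module F W] [Module K W] (U V : Submodule F W) : Prop :=
  ∃ (σ : K ≃+* K) (g : W ≃+ W), (∀ (c : K) (w : W), g (c • w) = σ c • g w) ∧
    g '' (U : Set W) = (V : Set W)

/-- The `F`-linear set `L_U` of `PG(W, K)`, with maximum field of linearity `F`, is simple: every
`F`-subspace `V` of the same dimension with `L_U = L_V` is in the `ΓL(W, K)`-orbit of `U`. -/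
def IsSimpleLinearSet {F : Type*} (K : Type*) {W : Type*} [Field F] [Field K] [Algebra F K]
    [AddCommGroup W] [Module F W] [Module K W] (U : Submodule F W) : Prop :=
  HasMaxLinearityDegree F (linearSet U : Set (ℙ K W)) 1 ∧
    ∀ V : Submodule F W, Module.finrank F U = Module.finrank F V →
      (linearSet U : Set (ℙ K W)) = linearSet V → SameGammaLOrbit K U V

section QPolynomials

variable (F : Type*) {K : Type*} [Field F] [Fintype F] [Field K] [Algebra F K] {n : ℕ}

/-- The `F`-linear map `x ↦ c x ^ (q ^ i)` of `K`, where `q = |F|`. -/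
def qMonomial (c : K) (i : ℕ) : K →ₗ[F] K :=
  c • ((FiniteField.frobeniusAlgHom F K) ^ i).toLinearMap

theorem qMonomial_apply (c : K) (i : ℕ) (x : K) :
    qMonomial F c i x = c * x ^ (Fintype.card F ^ i) := by
  have h : ∀ (j : ℕ) (y : K),
      ((FiniteField.frobeniusAlgHom F K) ^ j) y = y ^ (Fintype.card F ^ j) := by
    intro j
    induction j with
    | zero => intro y; simp
    | succ j ih => intro y; rw [pow_succ, AlgHom.mul_apply, ih]; simp [pow_succ', pow_mul]
  simp [qMonomial, h]

/-- The `q`-polynomial `f(x) = ∑_{i < n} a_i x^(q^i)`, as an `F`-linear map of `K`. -/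
def qPolynomial (a : Fin n → K) : K →ₗ[F] K :=
  ∑ i : Fin n, qMonomial F (a i) i

theorem qPolynomial_apply (a : Fin n → K) (x : K) :
    qPolynomial F a x = ∑ i : Fin n, a i * x ^ (Fintype.card F ^ (i : ℕ)) := by
  simp [qPolynomial, qMonomial_apply]

/-- The adjoint `q`-polynomial `∑_{i < n} a_i^(q^(n-i)) x^(q^(n-i))` of
`f(x) = ∑_{i < n} a_i x^(q^i)`, with respect to the form `Tr(xy)` (for `[K : F] = n`). -/
def qAdjoint (a : Fin n → K) : K →ₗ[F] K :=
  ∑ i : Fin n, qMonomial F (a i ^ (Fintype.card F ^ (n - (i : ℕ)))) (n - (i : ℕ))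

theorem qAdjoint_apply (a : Fin n → K) (x : K) :
    qAdjoint F a x = ∑ i : Fin n,
      a i ^ (Fintype.card F ^ (n - (i : ℕ))) * x ^ (Fintype.card F ^ (n - (i : ℕ))) := by
  simp [qAdjoint, qMonomial_apply]

end QPolynomials

/-! A set of rank 4 misses one of the q⁴ + 1 points of the line. Once a missed point is moved to
⟨(0, 1)⟩, every competing subspace is a graph U_f, and its linear set is the set of slopes f(x)/x.
Each slope is attained by q^k - 1 nonzero x for some k ≥ 1, a number equal to -1 in K, so every sum
∑ G(f(x)/x) depends only on the slope set (`sum_units_div`). Taking G(z) to be z, z^(1+q), z^(1+q²),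
z^(1+q+q²) and, if a₂ = 0, the norm, fixes a₀, a₁a₃^q, a₂a₂^(q²) and the sum of two terms whose
product is already known (`coeff_relations`). The two terms are thus determined up to order,
exchanging them amounts to passing to the adjoint, and Hilbert 90 shows that the second polynomial
is a scaling of f or of its adjoint (`exists_scalar_of_coeff_relations`).

It remains to match U_f with the graph of its adjoint (`sameGammaLOrbit_adjoint`). If Tr(pxy +
b(xf(y) + f(x)y) + df(x)f(y)) vanishes identically, then (p, b, d) yields a matrix carrying one
graph to the other, invertible when pd ≠ b². Such triples form an F-space of dimension at least 12 -
10 = 2. If all of them are degenerate, then the image of x ↦ f(x) + sx, for a common s = b/d, is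
totally isotropic for two independent trace forms, hence lies in a multiple of F_{q²}; this forces
N(a₁) = N(a₃), and then an explicit semilinear map works. -/

/-! ### Coefficients from sums over the multiplicative group -/

/-- In base `q`, with four summands, `1 + q + q² + q³` is represented modulo `q⁴ - 1` only by the
four distinct powers. -/
theorem powers_pairwise_ne_of_dvd {q : ℕ} (hq : 2 ≤ q) (i j k l : Fin 4)
    (h : ((q : ℤ) ^ 4 - 1) ∣ ((q ^ (i : ℕ) + q ^ (j : ℕ) + q ^ (k : ℕ) + q ^ (l : ℕ) : ℕ) : ℤ) -
      ((1 + q + q ^ 2 + q ^ 3 : ℕ) : ℤ)) :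
    i ≠ j ∧ i ≠ k ∧ i ≠ l ∧ j ≠ k ∧ j ≠ l ∧ k ≠ l := by
  have hS : ∀ i : Fin 4, q ^ (i : ℕ) = if i = 0 then 1 else if i = 1 then q else
      if i = 2 then q ^ 2 else q ^ 3 := by
    intro i; fin_cases i <;> simp
  -- The size bound fails for q = 2, where 4·2³ - 15 = 17 exceeds the modulus 15; that case is a
  -- finite check.
  rcases hq.eq_or_lt with rfl | hq3
  · revert i j k l
    decide
  have h2 : 3 * q ≤ q ^ 2 := by nlinarith
  have h3 : 3 * q ^ 2 ≤ q ^ 3 := by nlinarith [sq_nonneg q]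
  have h4 : 3 * q ^ 3 ≤ q ^ 4 := by
    rw [pow_succ q 3, mul_comm]; exact Nat.mul_le_mul_left _ hq3
  have hle : ∀ i : Fin 4, q ^ (i : ℕ) ≤ q ^ 3 ∧ 1 ≤ q ^ (i : ℕ) := fun i =>
    ⟨Nat.pow_le_pow_right (by omega) (by omega), Nat.one_le_pow _ _ (by omega)⟩
  -- For q ≥ 3 the difference is smaller than q⁴ - 1 in absolute value, so it vanishes. The linear
  -- gaps 3q ≤ q² and 3q² ≤ q³ then separate the cases.
  have h0 := Int.eq_zero_of_abs_lt_dvd h (by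
    have := hle i; have := hle j; have := hle k; have := hle l
    have e4 : (q : ℤ) ^ 4 = ((q ^ 4 : ℕ) : ℤ) := by push_cast; ring
    rw [e4, abs_lt]
    constructor <;> omega)
  rw [hS i, hS j, hS k, hS l] at h0
  clear h hle hS
  generalize q ^ 2 = y at *
  generalize q ^ 3 = w at *
  clear h4
  fin_cases i <;> fin_cases j <;> fin_cases k <;> fin_cases l <;>
    first
    | decide
    | (exfalso; simp at h0; omega)

theorem sum_four_of_pairwise_ne {M : Type*} [AddCommMonoid M] {i j k l : Fin 4}
    (h : i ≠ j ∧ i ≠ k ∧ i ≠ l ∧ j ≠ k ∧ j ≠ l ∧ k ≠ l) (g : Fin 4 → M) :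
    g i + g j + g k + g l = ∑ r, g r := by
  have hinj : Function.Injective ![i, j, k, l] := by
    revert i j k l
    decide
  rw [← (Finite.injective_iff_bijective.1 hinj).sum_comp g]
  simp [Fin.sum_univ_four]

section LinearSetsOfRankFour

variable {F K : Type*} [Field F] [Fintype F] [Field K]

/-- The sum over `Kˣ` of a product of four `q`-polynomials divided by `x^(1 + q + q² + q³)` is minus
the permanent of the matrix of coefficients. -/
theorem sum_units_prod_four [Fintype K] [DecidableEq K] (hK : Fintype.card K = Fintype.card F ^ 4)
    (A B C D : Fin 4 → K) :
    ∑ x : Kˣ, (∑ i, A i * (x : K) ^ (Fintype.card F ^ (i : ℕ))) *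
      (∑ i, B i * (x : K) ^ (Fintype.card F ^ (i : ℕ))) *
      (∑ i, C i * (x : K) ^ (Fintype.card F ^ (i : ℕ))) *
      (∑ i, D i * (x : K) ^ (Fintype.card F ^ (i : ℕ))) /
      (x : K) ^ (1 + Fintype.card F + Fintype.card F ^ 2 + Fintype.card F ^ 3) =
    - ∑ i, ∑ j, ∑ k, ∑ l, if i ≠ j ∧ i ≠ k ∧ i ≠ l ∧ j ≠ k ∧ j ≠ l ∧ k ≠ l then
      A i * B j * C k * D l else 0 := by
  set q := Fintype.card F with hqdef
  have hq : 2 ≤ q := Fintype.one_lt_card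
  have hcard : Fintype.card Kˣ = q ^ 4 - 1 := by rw [Fintype.card_units, hK]
  have hcast : ((Fintype.card Kˣ : ℕ) : K) = -1 := by
    have h1 := Nat.cast_card_eq_zero K
    have h2 : Fintype.card Kˣ + 1 = Fintype.card K := by
      rw [hcard, hK]; exact Nat.sub_add_cancel (Nat.one_le_pow _ _ (by omega))
    rw [← h2] at h1; push_cast at h1
    exact eq_neg_of_add_eq_zero_left h1
  have key : ∀ i j k l : Fin 4, ∑ x : Kˣ, (x : K) ^ (q ^ (i : ℕ)) * (x : K) ^ (q ^ (j : ℕ)) *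
      (x : K) ^ (q ^ (k : ℕ)) * (x : K) ^ (q ^ (l : ℕ)) / (x : K) ^ (1 + q + q ^ 2 + q ^ 3) =
      if i ≠ j ∧ i ≠ k ∧ i ≠ l ∧ j ≠ k ∧ j ≠ l ∧ k ≠ l then -1 else 0 := by
    intro i j k l
    set z : ℤ := ((q ^ (i : ℕ) + q ^ (j : ℕ) + q ^ (k : ℕ) + q ^ (l : ℕ) : ℕ) : ℤ) -
      ((1 + q + q ^ 2 + q ^ 3 : ℕ) : ℤ) with hz
    -- Each monomial quotient is a character x ↦ x^z of the cyclic group Kˣ. Its sum is |Kˣ| = -1 if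
    -- it is trivial, that is if q⁴ - 1 divides z, and 0 otherwise.
    let f : Kˣ →* K := (Units.coeHom K).comp (zpowGroupHom z)
    have hf : ∀ x : Kˣ, f x = (x : K) ^ (q ^ (i : ℕ)) * (x : K) ^ (q ^ (j : ℕ)) *
      (x : K) ^ (q ^ (k : ℕ)) * (x : K) ^ (q ^ (l : ℕ)) / (x : K) ^ (1 + q + q ^ 2 + q ^ 3) := by
      intro x
      have : f x = (x : K) ^ z := by simp [f]
      rw [this, hz, zpow_sub₀ x.ne_zero, zpow_natCast, zpow_natCast]
      simp only [pow_add]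
    simp_rw [← hf]
    rw [sum_hom_units]
    have hiff : f = 1 ↔ i ≠ j ∧ i ≠ k ∧ i ≠ l ∧ j ≠ k ∧ j ≠ l ∧ k ≠ l := by
      constructor
      · intro h1
        apply powers_pairwise_ne_of_dvd hq
        obtain ⟨g, hg⟩ := IsCyclic.exists_generator (α := Kˣ)
        have h2 : g ^ z = 1 := by
          have := DFunLike.congr_fun h1 g
          ext; simpa [f] using this
        have h3 := orderOf_dvd_iff_zpow_eq_one.2 h2
        rw [orderOf_eq_card_of_forall_mem_zpowers hg, Nat.card_eq_fintype_card, hcard,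
          Nat.cast_sub (Nat.one_le_pow _ _ (by omega))] at h3
        rw [hz] at h3; exact_mod_cast h3
      · intro h1
        have : z = 0 := by
          rw [hz, sum_four_of_pairwise_ne h1 (fun i => q ^ (i : ℕ))]
          simp [Fin.sum_univ_four]
        ext x
        simp [f, this]
    simp only [hiff]
    split_ifs
    · exact hcast
    · simp
  calc _ = ∑ x : Kˣ, ∑ i, ∑ j, ∑ k, ∑ l, A i * B j * C k * D l *
        ((x : K) ^ (q ^ (i : ℕ)) * (x : K) ^ (q ^ (j : ℕ)) * (x : K) ^ (q ^ (k : ℕ)) *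
          (x : K) ^ (q ^ (l : ℕ)) / (x : K) ^ (1 + q + q ^ 2 + q ^ 3)) := by
        refine Finset.sum_congr rfl fun x _ => ?_
        rw [mul_assoc, mul_assoc]
        simp_rw [Finset.sum_mul, Finset.mul_sum, Finset.sum_div]
        refine Finset.sum_congr rfl fun i _ => Finset.sum_congr rfl fun j _ =>
          Finset.sum_congr rfl fun k _ => Finset.sum_congr rfl fun l _ => ?_
        ring
    _ = ∑ i, ∑ j, ∑ k, ∑ l, A i * B j * C k * D l *
        ∑ x : Kˣ, ((x : K) ^ (q ^ (i : ℕ)) * (x : K) ^ (q ^ (j : ℕ)) * (x : K) ^ (q ^ (k : ℕ)) *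
          (x : K) ^ (q ^ (l : ℕ)) / (x : K) ^ (1 + q + q ^ 2 + q ^ 3)) := by
        simp_rw [Finset.mul_sum]
        rw [Finset.sum_comm]
        refine Finset.sum_congr rfl fun i _ => ?_
        rw [Finset.sum_comm]
        refine Finset.sum_congr rfl fun j _ => ?_
        rw [Finset.sum_comm]
        refine Finset.sum_congr rfl fun k _ => ?_
        rw [Finset.sum_comm]
    _ = _ := by
        simp_rw [key, ← Finset.sum_neg_distrib]
        refine Finset.sum_congr rfl fun i _ => Finset.sum_congr rfl fun j _ =>
          Finset.sum_congr rfl fun k _ => Finset.sum_congr rfl fun l _ => ?_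
        split_ifs <;> simp

/-- The indicator sum of `sum_units_prod_four` expanded. -/
theorem permanent_four_expand {R : Type*} [CommRing R] (A B C D : Fin 4 → R) :
    (∑ i, ∑ j, ∑ k, ∑ l, if i ≠ j ∧ i ≠ k ∧ i ≠ l ∧ j ≠ k ∧ j ≠ l ∧ k ≠ l then
      A i * B j * C k * D l else 0) =
    A 0 * B 1 * C 2 * D 3 + A 0 * B 1 * C 3 * D 2 + A 0 * B 2 * C 1 * D 3 +
    A 0 * B 2 * C 3 * D 1 + A 0 * B 3 * C 1 * D 2 + A 0 * B 3 * C 2 * D 1 +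
    A 1 * B 0 * C 2 * D 3 + A 1 * B 0 * C 3 * D 2 + A 1 * B 2 * C 0 * D 3 +
    A 1 * B 2 * C 3 * D 0 + A 1 * B 3 * C 0 * D 2 + A 1 * B 3 * C 2 * D 0 +
    A 2 * B 0 * C 1 * D 3 + A 2 * B 0 * C 3 * D 1 + A 2 * B 1 * C 0 * D 3 +
    A 2 * B 1 * C 3 * D 0 + A 2 * B 3 * C 0 * D 1 + A 2 * B 3 * C 1 * D 0 +
    A 3 * B 0 * C 1 * D 2 + A 3 * B 0 * C 2 * D 1 + A 3 * B 1 * C 0 * D 2 +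
    A 3 * B 1 * C 2 * D 0 + A 3 * B 2 * C 0 * D 1 + A 3 * B 2 * C 1 * D 0 := by
  simp [Fin.sum_univ_four]
  ring

variable [Algebra F K]

local notation "φ" => FiniteField.frobeniusAlgHom F K

theorem frobenius_four [Fintype K] (hK : Fintype.card K = Fintype.card F ^ 4) (x : K) :
    φ (φ (φ (φ x))) = x := by
  simp only [FiniteField.frobeniusAlgHom_apply, ← pow_mul]
  conv_rhs => rw [← FiniteField.pow_card x, hK]
  congr 1; ring

theorem sum_four_mul_pow_eq (A : Fin 4 → K) (x : K) :
    ∑ i, A i * x ^ (Fintype.card F ^ (i : ℕ)) =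
      A 0 * x + A 1 * φ x + A 2 * φ (φ x) + A 3 * φ (φ (φ x)) := by
  simp only [Fin.sum_univ_four, FiniteField.frobeniusAlgHom_apply, ← pow_mul]
  simp [pow_succ, mul_assoc]

theorem qPolynomial_four_apply (a : Fin 4 → K) (x : K) :
    qPolynomial F a x = a 0 * x + a 1 * φ x + a 2 * φ (φ x) + a 3 * φ (φ (φ x)) := by
  rw [qPolynomial_apply, sum_four_mul_pow_eq]

/-- The coefficients of the adjoint `q`-polynomial for `n = 4`. -/
def adjointCoeff (F : Type*) {K : Type*} [Field F] [Fintype F] [Field K] [Algebra F K]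
    (a : Fin 4 → K) : Fin 4 → K :=
  ![a 0, FiniteField.frobeniusAlgHom F K (a 3),
    FiniteField.frobeniusAlgHom F K (FiniteField.frobeniusAlgHom F K (a 2)),
    FiniteField.frobeniusAlgHom F K (FiniteField.frobeniusAlgHom F K
      (FiniteField.frobeniusAlgHom F K (a 1)))]

theorem qAdjoint_four [Fintype K] (hK : Fintype.card K = Fintype.card F ^ 4) (a : Fin 4 → K) :
    qAdjoint F a = qPolynomial F (adjointCoeff F a) := by
  ext x
  rw [qPolynomial_four_apply, qAdjoint_apply]
  have h2 : ∀ x : K, x ^ Fintype.card F ^ 2 = φ (φ x) := fun x => by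
    simp [← pow_mul, pow_two]
  have h3 : ∀ x : K, x ^ Fintype.card F ^ 3 = φ (φ (φ x)) := fun x => by
    simp [← pow_mul, pow_succ, mul_assoc]
  have h4 : ∀ x : K, x ^ Fintype.card F ^ 4 = x := fun x => by
    rw [← hK, FiniteField.pow_card]
  simp only [Fin.sum_univ_four]
  simp only [adjointCoeff, Fin.val_zero, Fin.val_one, Fin.val_two, Nat.sub_zero,
    show ((3 : Fin 4) : ℕ) = 3 from rfl, show 4 - 1 = 3 from rfl, show 4 - 2 = 2 from rfl,
    show 4 - 3 = 1 from rfl, h2, h3, h4, pow_one]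
  simp
  ring

/-- Factors chosen to be monomials cancel conjugates of x in the denominator, so the same formula
also evaluates products of fewer than four q-polynomials. -/
theorem sum_units_prod_frobenius [Fintype K] [DecidableEq K]
    (hK : Fintype.card K = Fintype.card F ^ 4) (A B C D : Fin 4 → K) :
    ∑ x : Kˣ, (A 0 * (x : K) + A 1 * φ x + A 2 * φ (φ x) + A 3 * φ (φ (φ x))) *
      (B 0 * (x : K) + B 1 * φ x + B 2 * φ (φ x) + B 3 * φ (φ (φ x))) *
      (C 0 * (x : K) + C 1 * φ x + C 2 * φ (φ x) + C 3 * φ (φ (φ x))) *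
      (D 0 * (x : K) + D 1 * φ x + D 2 * φ (φ x) + D 3 * φ (φ (φ x))) /
      (x * φ x * φ (φ x) * φ (φ (φ x))) =
    - (A 0 * B 1 * C 2 * D 3 + A 0 * B 1 * C 3 * D 2 + A 0 * B 2 * C 1 * D 3 +
    A 0 * B 2 * C 3 * D 1 + A 0 * B 3 * C 1 * D 2 + A 0 * B 3 * C 2 * D 1 +
    A 1 * B 0 * C 2 * D 3 + A 1 * B 0 * C 3 * D 2 + A 1 * B 2 * C 0 * D 3 +
    A 1 * B 2 * C 3 * D 0 + A 1 * B 3 * C 0 * D 2 + A 1 * B 3 * C 2 * D 0 +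
    A 2 * B 0 * C 1 * D 3 + A 2 * B 0 * C 3 * D 1 + A 2 * B 1 * C 0 * D 3 +
    A 2 * B 1 * C 3 * D 0 + A 2 * B 3 * C 0 * D 1 + A 2 * B 3 * C 1 * D 0 +
    A 3 * B 0 * C 1 * D 2 + A 3 * B 0 * C 2 * D 1 + A 3 * B 1 * C 0 * D 2 +
    A 3 * B 1 * C 2 * D 0 + A 3 * B 2 * C 0 * D 1 + A 3 * B 2 * C 1 * D 0) := by
  rw [← permanent_four_expand, ← sum_units_prod_four hK]
  refine Finset.sum_congr rfl fun x _ => ?_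
  simp only [sum_four_mul_pow_eq]
  congr 1
  simp only [FiniteField.frobeniusAlgHom_apply, ← pow_mul]
  ring

/-- The number of nonzero `x` with `f x = z x` is `-1` or `0` in `K`, so that a sum over the nonzero
`x` of a function of `f x / x` is determined by the set of the values `f x / x`. -/
theorem sum_units_div [Fintype K] [DecidableEq K] (f : K →ₗ[F] K) (G : K → K) :
    ∑ x : Kˣ, G (f x / x) = - ∑ z with ∃ x : Kˣ, f x / x = z, G z := by
  rw [← Finset.sum_fiberwise (s := Finset.univ) (g := fun x : Kˣ => f x / (x : K)), Finset.sum_filter,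
    ← Finset.sum_neg_distrib]
  refine Finset.sum_congr rfl fun z _ => ?_
  have h1 : ∑ x ∈ ({x : Kˣ | f x / (x : K) = z} : Finset Kˣ), G (f x / x) =
      (({x : Kˣ | f x / (x : K) = z} : Finset Kˣ).card : K) * G z := by
    rw [Finset.sum_congr rfl (g := fun _ => G z)]
    · simp
    · intro x hx
      rw [(Finset.mem_filter.1 hx).2]
  rw [h1]
  split_ifs with hz
  · suffices h : (({x : Kˣ | f x / (x : K) = z} : Finset Kˣ).card : K) = -1 by
      rw [h]; ring
    -- Together with 0, the fibre over z is the kernel of f - z, an F-space of positive dimension,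
    -- whose cardinality is 0 in K.
    let N : Submodule F K := LinearMap.ker (f - LinearMap.mulLeft F z)
    have hN : ∀ x, x ∈ N ↔ f x = z * x := fun x => by simp [N, sub_eq_zero]
    have hmem : ∀ x : Kˣ, f x / (x : K) = z ↔ (x : K) ∈ N := fun x => by
      rw [hN, div_eq_iff x.ne_zero]
    have hcard : ({x : Kˣ | f x / (x : K) = z} : Finset Kˣ).card + 1 = Nat.card N := by
      classical
      rw [← Finset.card_map ⟨Units.val, Units.val_injective⟩, ← Finset.card_insert_of_notMem
        (a := (0 : K)) (by simp), Nat.card_eq_fintype_card, Fintype.card_subtype]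
      congr 1
      ext x
      simp only [Finset.mem_insert, Finset.mem_map, Finset.mem_filter, Finset.mem_univ, true_and,
        Function.Embedding.coeFn_mk, hmem]
      constructor
      · rintro (rfl | ⟨u, hu, rfl⟩)
        · exact N.zero_mem
        · exact hu
      · intro hx
        by_cases h0 : x = 0
        · exact Or.inl h0
        · exact Or.inr ⟨Units.mk0 x h0, hx, rfl⟩
    obtain ⟨x, hx⟩ := hz
    have hne : Nontrivial N := ⟨⟨⟨x, (hmem x).1 hx⟩, 0, fun h => x.ne_zero (congrArg Subtype.val h)⟩⟩
    have h0 : ((Nat.card N : ℕ) : K) = 0 := by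
      rw [Module.natCard_eq_pow_finrank (K := F), Nat.card_eq_fintype_card, Nat.cast_pow,
        ← map_natCast (algebraMap F K), Nat.cast_card_eq_zero, map_zero,
        zero_pow Module.finrank_pos.ne']
    rw [← hcard, Nat.cast_add, Nat.cast_one] at h0
    exact eq_neg_of_add_eq_zero_left h0
  · rw [Finset.filter_false_of_mem]
    · simp
    · intro x _ hx
      exact hz ⟨x, hx⟩

/-! ### Coefficient relations from equal slope sets -/

/-- The relations between the coefficients of two `q`-polynomials with the same power sums of
`f x / x`. -/
theorem coeff_relations [Fintype K] [DecidableEq K] (hK : Fintype.card K = Fintype.card F ^ 4)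
    (a b : Fin 4 → K) (H : ∀ G : K → K, ∑ x : Kˣ, G (qPolynomial F a x / x) =
      ∑ x : Kˣ, G (qPolynomial F b x / x)) :
    a 0 = b 0 ∧ a 1 * φ (a 3) = b 1 * φ (b 3) ∧ a 2 * φ (φ (a 2)) = b 2 * φ (φ (b 2)) ∧
    a 1 * φ (a 1) * φ (φ (a 2)) + a 2 * φ (a 3) * φ (φ (a 3)) =
      b 1 * φ (b 1) * φ (φ (b 2)) + b 2 * φ (b 3) * φ (φ (b 3)) ∧
    (a 2 = 0 → b 2 = 0 →
      a 1 * φ (a 1) * φ (φ (a 1)) * φ (φ (φ (a 1))) +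
        a 3 * φ (a 3) * φ (φ (a 3)) * φ (φ (φ (a 3))) =
      b 1 * φ (b 1) * φ (φ (b 1)) * φ (φ (φ (b 1))) +
        b 3 * φ (b 3) * φ (φ (b 3)) * φ (φ (φ (b 3)))) := by
  have h4 := frobenius_four (F := F) hK
  have hne : ∀ x : Kˣ, (x : K) ≠ 0 ∧ φ (x : K) ≠ 0 ∧ φ (φ (x : K)) ≠ 0 ∧ φ (φ (φ (x : K))) ≠ 0 :=
    fun x => by simp [x.ne_zero]
  have S1 : ∀ c : Fin 4 → K, ∑ x : Kˣ, (qPolynomial F c x / x : K) = - c 0 := by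
    intro c
    refine (Finset.sum_congr rfl fun x _ => ?_).trans
      ((sum_units_prod_frobenius (F := F) hK c ![0, 1, 0, 0] ![0, 0, 1, 0] ![0, 0, 0, 1]).trans ?_)
    · obtain ⟨h0, h1, h2, h3⟩ := hne x
      simp only [qPolynomial_four_apply, Matrix.cons_val]
      field_simp
      ring
    · simp only [Matrix.cons_val]
      ring
  have S2 : ∀ c : Fin 4 → K, ∑ x : Kˣ,
      (qPolynomial F c x / x : K) * φ (qPolynomial F c x / x : K) =
      - (c 0 * φ (c 0) + c 1 * φ (c 3)) := by
    intro c
    refine (Finset.sum_congr rfl fun x _ => ?_).trans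
      ((sum_units_prod_frobenius (F := F) hK c
        -- Since φ⁴ = 1, the conjugate φ(f(x)) has the cyclically shifted coefficients, each with φ
        -- applied.
        ![φ (c 3), φ (c 0), φ (c 1), φ (c 2)]
        ![0, 0, 1, 0]
        ![0, 0, 0, 1]).trans ?_)
    · obtain ⟨h0, h1, h2, h3⟩ := hne x
      simp only [map_div₀, qPolynomial_four_apply, map_add, map_mul, h4, Matrix.cons_val]
      field_simp
      ring
    · simp only [Matrix.cons_val]
      ring
  have S3 : ∀ c : Fin 4 → K, ∑ x : Kˣ,
      (qPolynomial F c x / x : K) * φ (φ (qPolynomial F c x / x : K)) =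
      - (c 0 * φ (φ (c 0)) + c 2 * φ (φ (c 2))) := by
    intro c
    refine (Finset.sum_congr rfl fun x _ => ?_).trans
      ((sum_units_prod_frobenius (F := F) hK c
        ![0, 1, 0, 0]
        ![φ (φ (c 2)), φ (φ (c 3)), φ (φ (c 0)), φ (φ (c 1))]
        ![0, 0, 0, 1]).trans ?_)
    · obtain ⟨h0, h1, h2, h3⟩ := hne x
      simp only [map_div₀, qPolynomial_four_apply, map_add, map_mul, h4, Matrix.cons_val]
      field_simp
      ring
    · simp only [Matrix.cons_val]
      ring
  have S4 : ∀ c : Fin 4 → K, ∑ x : Kˣ,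
      (qPolynomial F c x / x : K) * φ (qPolynomial F c x / x : K) *
        φ (φ (qPolynomial F c x / x : K)) =
      - (c 0 * φ (c 0) * φ (φ (c 0)) + c 0 * φ (c 1 * φ (c 3)) +
    c 1 * φ (c 3) * φ (φ (c 0)) + c 2 * φ (φ (c 2)) * φ (c 0) +
    (c 1 * φ (c 1) * φ (φ (c 2)) + c 2 * φ (c 3) * φ (φ (c 3)))) := by
    intro c
    refine (Finset.sum_congr rfl fun x _ => ?_).trans
      ((sum_units_prod_frobenius (F := F) hK c
        ![φ (c 3), φ (c 0), φ (c 1), φ (c 2)]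
        ![φ (φ (c 2)), φ (φ (c 3)), φ (φ (c 0)), φ (φ (c 1))]
        ![0, 0, 0, 1]).trans ?_)
    · obtain ⟨h0, h1, h2, h3⟩ := hne x
      simp only [map_div₀, qPolynomial_four_apply, map_add, map_mul, h4, Matrix.cons_val]
      field_simp
      ring
    · simp only [Matrix.cons_val]
      simp only [map_mul]
      ring
  have S5 : ∀ c : Fin 4 → K, c 2 = 0 → ∑ x : Kˣ, (qPolynomial F c x / x : K) *
      φ (qPolynomial F c x / x : K) * φ (φ (qPolynomial F c x / x : K)) *
      φ (φ (φ (qPolynomial F c x / x : K))) =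
      - (c 0 * φ (c 0) * φ (φ (c 0)) * φ (φ (φ (c 0))) +
        c 1 * φ (c 3) * φ (φ (c 0)) * φ (φ (φ (c 0))) +
        c 0 * φ (c 1 * φ (c 3)) * φ (φ (φ (c 0))) +
        c 0 * φ (c 0) * φ (φ (c 1 * φ (c 3))) +
        φ (c 0) * φ (φ (c 0)) * φ (φ (φ (c 1 * φ (c 3)))) +
        c 1 * φ (c 3) * φ (φ (c 1 * φ (c 3))) + φ (c 1 * φ (c 3)) * φ (φ (φ (c 1 * φ (c 3)))) +
        (c 1 * φ (c 1) * φ (φ (c 1)) * φ (φ (φ (c 1))) +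
          c 3 * φ (c 3) * φ (φ (c 3)) * φ (φ (φ (c 3))))) := by
    intro c hc
    refine (Finset.sum_congr rfl fun x _ => ?_).trans
      ((sum_units_prod_frobenius (F := F) hK c
        ![φ (c 3), φ (c 0), φ (c 1), φ (c 2)]
        ![φ (φ (c 2)), φ (φ (c 3)), φ (φ (c 0)), φ (φ (c 1))]
        ![φ (φ (φ (c 1))), φ (φ (φ (c 2))), φ (φ (φ (c 3))), φ (φ (φ (c 0)))]).trans ?_)
    · obtain ⟨h0, h1, h2, h3⟩ := hne x
      simp only [map_div₀, qPolynomial_four_apply, map_add, map_mul, h4, Matrix.cons_val]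
      field_simp
      ring
    · simp only [Matrix.cons_val, hc, map_zero, map_mul, h4]
      ring
  have e0 : a 0 = b 0 := by
    have := H fun z => z
    rw [S1, S1] at this
    exact neg_injective this
  have e1 : a 1 * φ (a 3) = b 1 * φ (b 3) := by
    have := H fun z => z * φ z
    rw [S2, S2, e0] at this
    linear_combination -this
  have e2 : a 2 * φ (φ (a 2)) = b 2 * φ (φ (b 2)) := by
    have := H fun z => z * φ (φ z)
    rw [S3, S3, e0] at this
    linear_combination -this
  refine ⟨e0, e1, e2, ?_, fun ha hb => ?_⟩
  · have := H fun z => z * φ z * φ (φ z)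
    rw [S4, S4, e0, e1, e2] at this
    linear_combination -this
  · have := H fun z => z * φ z * φ (φ z) * φ (φ (φ z))
    rw [S5 a ha, S5 b hb, e0, e1] at this
    linear_combination -this

/-! ### Hilbert 90 and recovery of the polynomial -/

/-- In a cyclic group of order de, the kernel of the e-th power map is the image of the d-th power
map. -/
theorem exists_pow_eq_of_pow_eq_one {K : Type*} [Field K] [Fintype K] {d e : ℕ}
    (h : Fintype.card K = d * e + 1) {x : K} (hx : x ^ e = 1) : ∃ y : K, y ≠ 0 ∧ y ^ d = x := by
  classical
  have hpos : 0 < d * e := by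
    have := Fintype.one_lt_card (α := K)
    omega
  have he : 0 < e := Nat.pos_of_mul_pos_left hpos
  have hx0 : x ≠ 0 := by
    rintro rfl
    simp [he.ne'] at hx
  obtain ⟨g, hg⟩ := IsCyclic.exists_generator (α := Kˣ)
  obtain ⟨k, hk⟩ := hg (Units.mk0 x hx0)
  have hk : g ^ k = Units.mk0 x hx0 := hk
  have h1 : g ^ (k * (e : ℤ)) = 1 := by
    rw [zpow_mul, hk, zpow_natCast]
    ext; simpa using hx
  have h2 := orderOf_dvd_iff_zpow_eq_one.2 h1
  rw [orderOf_eq_card_of_forall_mem_zpowers hg, Nat.card_eq_fintype_card, Fintype.card_units, h,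
    Nat.add_sub_cancel, Nat.cast_mul] at h2
  obtain ⟨m, rfl⟩ := Int.dvd_of_mul_dvd_mul_right (by exact_mod_cast he.ne') h2
  refine ⟨(g ^ m : Kˣ), Units.ne_zero _, ?_⟩
  have := congrArg Units.val hk
  rw [mul_comm, zpow_mul, zpow_natCast] at this
  simpa using this

/-- Three factorisations of q⁴ - 1, one for each of the conditions x^(1+q+q²+q³) = 1, x^(1+q²) = 1
and x^(1+q) = 1; here r = q - 1. -/
theorem card_eq_factor {F K : Type*} [Fintype F] [Nonempty F]
    (hK : Nat.card K = Fintype.card F ^ 4) : ∃ r, Fintype.card F = r + 1 ∧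
    Nat.card K = r * (1 + Fintype.card F + Fintype.card F ^ 2 + Fintype.card F ^ 3) + 1 ∧
    Nat.card K = (r * (1 + Fintype.card F)) * (1 + Fintype.card F ^ 2) + 1 ∧
    Nat.card K = (r * (1 + Fintype.card F ^ 2)) * (1 + Fintype.card F) + 1 := by
  obtain ⟨r, hr⟩ := Nat.exists_eq_add_of_le' (Fintype.card_pos (α := F))
  refine ⟨r, hr, ?_, ?_, ?_⟩ <;> rw [hK, hr] <;> ring

/-- Hilbert's Theorem 90 for the extension of degree four. -/
theorem exists_frobenius_eq_mul [Fintype K] (hK : Fintype.card K = Fintype.card F ^ 4) {x : K}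
    (hx : x * φ x * φ (φ x) * φ (φ (φ x)) = 1) : ∃ y, y ≠ 0 ∧ φ y = x * y := by
  obtain ⟨r, hr, h1, -, -⟩ := card_eq_factor (F := F) (K := K) (by simpa using hK)
  rw [Nat.card_eq_fintype_card] at h1
  obtain ⟨y, hy, rfl⟩ := exists_pow_eq_of_pow_eq_one h1 (x := x) (by
    rw [← hx]; simp only [FiniteField.frobeniusAlgHom_apply]; ring)
  refine ⟨y, hy, ?_⟩
  rw [FiniteField.frobeniusAlgHom_apply, hr]; ring

theorem exists_frobenius_frobenius_eq_mul [Fintype K] (hK : Fintype.card K = Fintype.card F ^ 4)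
    {x : K} (hx : x * φ (φ x) = 1) : ∃ y, y ≠ 0 ∧ φ (φ y) = x * y := by
  obtain ⟨r, hr, -, h1, -⟩ := card_eq_factor (F := F) (K := K) (by simpa using hK)
  rw [Nat.card_eq_fintype_card] at h1
  obtain ⟨y, hy, rfl⟩ := exists_pow_eq_of_pow_eq_one h1 (x := x) (by
    rw [← hx]; simp only [FiniteField.frobeniusAlgHom_apply]; ring)
  refine ⟨y, hy, ?_⟩
  simp only [FiniteField.frobeniusAlgHom_apply, hr]; ring

theorem exists_fixed_frobenius_eq_mul [Fintype K] (hK : Fintype.card K = Fintype.card F ^ 4) {x : K}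
    (hx : x * φ x = 1) : ∃ y, y ≠ 0 ∧ φ y = x * y ∧ φ (φ y) = y := by
  obtain ⟨r, hr, -, -, h1⟩ := card_eq_factor (F := F) (K := K) (by simpa using hK)
  rw [Nat.card_eq_fintype_card] at h1
  obtain ⟨y, hy, rfl⟩ := exists_pow_eq_of_pow_eq_one h1 (x := x) (by
    rw [← hx]; simp only [FiniteField.frobeniusAlgHom_apply]; ring)
  have h4 := frobenius_four (F := F) hK y
  -- Here x = y^((q-1)(1+q²)), so y^(1+q²), which φ² fixes, is the required element.
  refine ⟨y * φ (φ y), by simp [hy], ?_, ?_⟩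
  · simp only [FiniteField.frobeniusAlgHom_apply, hr]; ring
  · rw [map_mul, map_mul, h4, mul_comm]

/-- The ratio b₁/a₁ has norm 1, so it is φ(y)/y for some y. The relation for the other coefficient
is then forced by h. If a₁ = 0, the ratio b₃/a₃ plays this role. -/
theorem exists_scalar_of_norm_eq [Fintype K] (hK : Fintype.card K = Fintype.card F ^ 4)
    {a₁ a₃ b₁ b₃ : K} (h : a₁ * φ a₃ = b₁ * φ b₃)
    (h₁ : a₁ * φ a₁ * φ (φ a₁) * φ (φ (φ a₁)) = b₁ * φ b₁ * φ (φ b₁) * φ (φ (φ b₁)))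
    (h₃ : a₃ * φ a₃ * φ (φ a₃) * φ (φ (φ a₃)) = b₃ * φ b₃ * φ (φ b₃) * φ (φ (φ b₃))) :
    ∃ y, y ≠ 0 ∧ b₁ * y = a₁ * φ y ∧ b₃ * y = a₃ * φ (φ (φ y)) := by
  have h4 := frobenius_four (F := F) hK
  have hinj : Function.Injective φ := (φ).injective
  by_cases ha : a₁ = 0
  · have hb : b₁ = 0 := by simpa [ha] using h₁
    by_cases ha3 : a₃ = 0
    · have hb3 : b₃ = 0 := by simpa [ha3] using h₃
      exact ⟨1, one_ne_zero, by simp [ha, hb], by simp [ha3, hb3]⟩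
    · have hb3 : b₃ ≠ 0 := by
        rintro rfl
        simp [ha3] at h₃
      obtain ⟨y, hy, hxy⟩ := exists_frobenius_eq_mul (F := F) hK (x := b₃ / a₃) (by
        simp only [map_div₀, div_mul_div_comm]
        rw [h₃, div_self (by simp [hb3])])
      -- Applying φ³ to (φ y)⁻¹ gives y⁻¹, because φ⁴ = 1.
      refine ⟨(φ y)⁻¹, by simp [hy], by simp [ha, hb], ?_⟩
      rw [map_inv₀, map_inv₀, map_inv₀, h4, hxy]
      field_simp
  · have hb : b₁ ≠ 0 := by
      rintro rfl
      simp [ha] at h₁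
    obtain ⟨y, hy, hxy⟩ := exists_frobenius_eq_mul (F := F) hK (x := b₁ / a₁) (by
      simp only [map_div₀, div_mul_div_comm]
      rw [h₁, div_self (by simp [hb])])
    refine ⟨y, hy, by rw [hxy]; field_simp, hinj ?_⟩
    rw [map_mul, map_mul, h4, hxy]
    field_simp
    linear_combination -h

/-- For use once the middle coefficients agree: a scalar fixed by φ² leaves the coefficient of
x^(q²) unchanged. -/
theorem exists_fixed_scalar_of_mul_eq [Fintype K] (hK : Fintype.card K = Fintype.card F ^ 4)
    {a₁ a₃ b₁ b₃ : K} (h : a₁ * φ a₃ = b₁ * φ b₃)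
    (h₁ : a₁ * φ a₁ = b₁ * φ b₁) (h₃ : a₃ * φ a₃ = b₃ * φ b₃) :
    ∃ y, y ≠ 0 ∧ φ (φ y) = y ∧ b₁ * y = a₁ * φ y ∧ b₃ * y = a₃ * φ (φ (φ y)) := by
  have h4 := frobenius_four (F := F) hK
  have hinj : Function.Injective φ := (φ).injective
  by_cases ha : a₁ = 0
  · have hb : b₁ = 0 := by simpa [ha] using h₁
    by_cases ha3 : a₃ = 0
    · have hb3 : b₃ = 0 := by simpa [ha3] using h₃
      exact ⟨1, one_ne_zero, by simp, by simp [ha, hb], by simp [ha3, hb3]⟩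
    · have hb3 : b₃ ≠ 0 := by
        rintro rfl
        simp [ha3] at h₃
      obtain ⟨y, hy, hxy, hyy⟩ := exists_fixed_frobenius_eq_mul (F := F) hK (x := b₃ / a₃) (by
        simp only [map_div₀, div_mul_div_comm]
        rw [h₃, div_self (by simp [hb3])])
      refine ⟨y, hy, hyy, by simp [ha, hb], ?_⟩
      rw [hyy, hxy]
      field_simp
  · have hb : b₁ ≠ 0 := by
      rintro rfl
      simp [ha] at h₁
    obtain ⟨y, hy, hxy, hyy⟩ := exists_fixed_frobenius_eq_mul (F := F) hK (x := b₁ / a₁) (by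
      simp only [map_div₀, div_mul_div_comm]
      rw [h₁, div_self (by simp [hb])])
    refine ⟨y, hy, hyy, by rw [hxy]; field_simp, hinj ?_⟩
    rw [map_mul, map_mul, h4, hxy]
    field_simp
    linear_combination -h

/-- Hilbert 90 for φ² gives z that scales b₂ to a₂. The remaining freedom is by scalars in F_{q²},
and cancelling a₂ from the cubic relations leaves the hypotheses of `exists_fixed_scalar_of_mul_eq`.
-/
theorem exists_scalar_of_ne_zero [Fintype K] (hK : Fintype.card K = Fintype.card F ^ 4)
    {a₁ a₂ a₃ b₁ b₂ b₃ : K} (ha : a₂ ≠ 0) (h : a₁ * φ a₃ = b₁ * φ b₃)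
    (h₂ : a₂ * φ (φ a₂) = b₂ * φ (φ b₂))
    (h₁ : a₁ * φ a₁ * φ (φ a₂) = b₁ * φ b₁ * φ (φ b₂))
    (h₃ : a₂ * φ a₃ * φ (φ a₃) = b₂ * φ b₃ * φ (φ b₃)) :
    ∃ y, y ≠ 0 ∧ b₁ * y = a₁ * φ y ∧ b₂ * y = a₂ * φ (φ y) ∧ b₃ * y = a₃ * φ (φ (φ y)) := by
  have h4 := frobenius_four (F := F) hK
  have hinj : Function.Injective φ := (φ).injective
  have hb : b₂ ≠ 0 := by
    rintro rfl
    simp [ha] at h₂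
  have ha' : φ (φ a₂) ≠ 0 := by simpa using ha
  obtain ⟨z, hz, hxz⟩ := exists_frobenius_frobenius_eq_mul (F := F) hK (x := b₂ / a₂) (by
    simp only [map_div₀, div_mul_div_comm]
    rw [h₂, div_self (by simp [hb])])
  have hz2 : b₂ * z = a₂ * φ (φ z) := by rw [hxz]; field_simp
  have hz2' : φ (φ b₂) * φ (φ z) = φ (φ a₂) * z := by
    have := congrArg (fun t => φ (φ t)) hz2
    simpa only [map_mul, h4] using this
  have n1 : φ z ≠ 0 := by simpa using hz
  have n2 : φ (φ z) ≠ 0 := by simpa using hz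
  have n3 : φ (φ (φ z)) ≠ 0 := by simpa using hz
  -- The new b₁ and b₃ are the coefficients of x ↦ z·b(x/z).
  obtain ⟨y, hy, hyy, e1, e3⟩ := exists_fixed_scalar_of_mul_eq (F := F) hK (a₁ := a₁) (a₃ := a₃)
    (b₁ := b₁ * z / φ z) (b₃ := b₃ * z / φ (φ (φ z)))
    (by
      simp only [map_div₀, map_mul, h4]
      field_simp
      exact h)
    (by
      simp only [map_div₀, map_mul]
      field_simp
      apply mul_right_cancel₀ ha'
      linear_combination φ (φ z) * h₁ + b₁ * φ b₁ * hz2')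
    (by
      apply hinj
      simp only [map_div₀, map_mul, h4]
      field_simp
      apply mul_left_cancel₀ ha
      linear_combination z * h₃ + φ b₃ * φ (φ b₃) * hz2)
  refine ⟨z * y, mul_ne_zero hz hy, ?_, ?_, ?_⟩
  · rw [map_mul]
    field_simp at e1
    linear_combination e1
  · rw [map_mul, map_mul, hyy]
    linear_combination y * hz2
  · rw [map_mul, map_mul, map_mul]
    field_simp at e3
    linear_combination e3

theorem eq_or_eq_of_add_eq_of_mul_eq {K : Type*} [CommRing K] [IsDomain K] {x y x' y' : K}
    (hs : x + y = x' + y') (hp : x * y = x' * y') :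
    (x = x' ∧ y = y') ∨ (x = y' ∧ y = x') := by
  have : (x - x') * (x - y') = 0 := by linear_combination x * hs - hp
  rcases mul_eq_zero.1 this with h | h
  · exact Or.inl ⟨by linear_combination h, by linear_combination hs - h⟩
  · exact Or.inr ⟨by linear_combination h, by linear_combination hs - h⟩

/-- The coefficient relations determine a `q`-polynomial, up to taking the adjoint and scaling. -/
theorem exists_scalar_of_coeff_relations [Fintype K] (hK : Fintype.card K = Fintype.card F ^ 4)
    (a b : Fin 4 → K) (h0 : a 0 = b 0) (h : a 1 * φ (a 3) = b 1 * φ (b 3))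
    (h2 : a 2 * φ (φ (a 2)) = b 2 * φ (φ (b 2)))
    (h3 : a 1 * φ (a 1) * φ (φ (a 2)) + a 2 * φ (a 3) * φ (φ (a 3)) =
      b 1 * φ (b 1) * φ (φ (b 2)) + b 2 * φ (b 3) * φ (φ (b 3)))
    (hN : a 2 = 0 → b 2 = 0 →
      a 1 * φ (a 1) * φ (φ (a 1)) * φ (φ (φ (a 1))) +
        a 3 * φ (a 3) * φ (φ (a 3)) * φ (φ (φ (a 3))) =
      b 1 * φ (b 1) * φ (φ (b 1)) * φ (φ (φ (b 1))) +
        b 3 * φ (b 3) * φ (φ (b 3)) * φ (φ (φ (b 3)))) :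
    ∃ c, (c = a ∨ c = adjointCoeff F a) ∧ ∃ y, y ≠ 0 ∧ b 0 * y = c 0 * y ∧ b 1 * y = c 1 * φ y ∧
      b 2 * y = c 2 * φ (φ y) ∧ b 3 * y = c 3 * φ (φ (φ y)) := by
  have h4 := frobenius_four (F := F) hK
  have hφ := congrArg φ h
  have hφφ := congrArg φ hφ
  have hφφφ := congrArg φ hφφ
  simp only [map_mul, h4] at hφ hφφ hφφφ
  by_cases ha : a 2 = 0
  · have hb : b 2 = 0 := by simpa [ha] using h2
    -- N(a₁)N(a₃) is the norm of a₁φ(a₃), hence known, so the pair of norms is determined up to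
    -- order. The exchanged order is treated with the adjoint coefficients.
    rcases eq_or_eq_of_add_eq_of_mul_eq (hN ha hb) (by
      linear_combination (a 1 * φ (a 3)) * φ (a 1) * φ (φ (a 3)) * φ (φ (a 1)) *
        φ (φ (φ (a 3))) * hφφφ + (a 1 * φ (a 3)) * φ (a 1) * φ (φ (a 3)) * (φ (φ (φ (b 1))) * b 3) * hφφ
        + (a 1 * φ (a 3)) * (φ (φ (φ (b 1))) * b 3) * (φ (φ (b 1)) * φ (φ (φ (b 3)))) * hφ
        + (φ (φ (φ (b 1))) * b 3) * (φ (φ (b 1)) * φ (φ (φ (b 3)))) * φ (b 1) * φ (φ (b 3)) * h)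
      with ⟨e1, e3⟩ | ⟨e1, e3⟩
    · obtain ⟨y, hy, f1, f3⟩ := exists_scalar_of_norm_eq (F := F) hK h e1 e3
      exact ⟨a, Or.inl rfl, y, hy, by rw [h0], f1, by simp [ha, hb], f3⟩
    · obtain ⟨y, hy, f1, f3⟩ := exists_scalar_of_norm_eq (F := F) hK (a₁ := φ (a 3))
        (a₃ := φ (φ (φ (a 1)))) (b₁ := b 1) (b₃ := b 3)
        (by rw [h4, ← h, mul_comm]) (by rw [h4, ← e3]; ring) (by rw [h4, ← e1]; ring)
      exact ⟨_, Or.inr rfl, y, hy, by simp [h0, adjointCoeff], f1, by simp [ha, hb, adjointCoeff], f3⟩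
  -- The product of the two cubic terms is (a₁φ(a₃))·φ(a₁φ(a₃))·(a₂φ²(a₂)), hence known.
  · rcases eq_or_eq_of_add_eq_of_mul_eq h3 (by
      linear_combination (a 1 * φ (a 3)) * (φ (a 1) * φ (φ (a 3))) * h2 +
        (a 1 * φ (a 3)) * (b 2 * φ (φ (b 2))) * hφ +
        (b 2 * φ (φ (b 2))) * (φ (b 1) * φ (φ (b 3))) * h) with ⟨e1, e3⟩ | ⟨e1, e3⟩
    · obtain ⟨y, hy, f1, f2, f3⟩ := exists_scalar_of_ne_zero (F := F) hK ha h h2 e1 e3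
      exact ⟨a, Or.inl rfl, y, hy, by rw [h0], f1, f2, f3⟩
    · obtain ⟨y, hy, f1, f2, f3⟩ := exists_scalar_of_ne_zero (F := F) hK (a₁ := φ (a 3))
        (a₂ := φ (φ (a 2))) (a₃ := φ (φ (φ (a 1)))) (b₁ := b 1) (b₂ := b 2) (b₃ := b 3)
        (by simpa using ha) (by rw [h4, ← h, mul_comm]) (by rw [h4, ← h2, mul_comm])
        (by rw [h4, ← e3]; ring) (by rw [h4, ← e1]; ring)
      exact ⟨_, Or.inr rfl, y, hy, by simp [h0, adjointCoeff], f1, f2, f3⟩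

/-! ### Semilinear equivalence of graphs -/

theorem SameGammaLOrbit.trans {F K W : Type*} [Field F] [Field K] [AddCommGroup W] [Module F W]
    [Module K W] {U V X : Submodule F W} (h : SameGammaLOrbit K U V) (h' : SameGammaLOrbit K V X) :
    SameGammaLOrbit K U X := by
  obtain ⟨σ, g, hg, hU⟩ := h
  obtain ⟨τ, g', hg', hV⟩ := h'
  refine ⟨σ.trans τ, g.trans g', fun c w => by simp [hg, hg'], ?_⟩
  rw [← hV, ← hU, Set.image_image]
  rfl

theorem SameGammaLOrbit.symm {F K W : Type*} [Field F] [Field K] [AddCommGroup W] [Module F W]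
    [Module K W] {U V : Submodule F W} (h : SameGammaLOrbit K U V) : SameGammaLOrbit K V U := by
  obtain ⟨σ, g, hg, hU⟩ := h
  refine ⟨σ.symm, g.symm, fun c w => ?_, ?_⟩
  · apply g.injective
    simp [hg]
  · rw [← hU, Set.image_image]
    simp

theorem SameGammaLOrbit.of_linearEquiv {F K W W' : Type*} [Field F] [Field K] [AddCommGroup W]
    [Module F W] [Module K W] [AddCommGroup W'] [Module F W'] [Module K W'] (e : W ≃ₗ[K] W')
    {U V : Submodule F W} {U' V' : Submodule F W'} (hU : ∀ w, e w ∈ U' ↔ w ∈ U)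
    (hV : ∀ w, e w ∈ V' ↔ w ∈ V) (h : SameGammaLOrbit K U' V') : SameGammaLOrbit K U V := by
  obtain ⟨σ, g, hg, hUV⟩ := h
  refine ⟨σ, (e.toAddEquiv.trans g).trans e.symm.toAddEquiv, fun c w => by simp [hg], ?_⟩
  ext w
  have := Set.ext_iff.1 hUV (e w)
  rw [SetLike.mem_coe, hV] at this
  rw [SetLike.mem_coe, ← this]
  constructor
  · rintro ⟨x, hx, rfl⟩
    exact ⟨e x, (hU x).2 hx, by simp⟩
  · rintro ⟨y, hy, hyw⟩
    exact ⟨e.symm y, (hU _).1 (by simpa using hy), by simp [hyw]⟩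

/-- A semilinear map, given by a matrix and a companion automorphism, that maps the graph of `f` into
the graph of `g`. -/
theorem sameGammaLOrbit_graph {F K : Type*} [Field F] [Field K] [Algebra F K] [Finite K]
    {f g : K →ₗ[F] K} (σ : K ≃+* K) (α β γ δ : K) (hdet : α * δ - β * γ ≠ 0)
    (h : ∀ x, g (α * σ x + β * σ (f x)) = γ * σ x + δ * σ (f x)) :
    SameGammaLOrbit K f.graph g.graph := by
  let M : K × K →+ K × K :=
    { toFun := fun w => (α * σ w.1 + β * σ w.2, γ * σ w.1 + δ * σ w.2)
      map_zero' := by simp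
      map_add' := fun v w => by ext <;> simp <;> ring }
  have hM : Function.Injective M := by
    rw [injective_iff_map_eq_zero]
    rintro ⟨x, y⟩ hxy
    obtain ⟨h1, h2⟩ := Prod.ext_iff.1 hxy
    simp only [M, AddMonoidHom.coe_mk, ZeroHom.coe_mk, Prod.fst_zero, Prod.snd_zero] at h1 h2
    have hx : (α * δ - β * γ) * σ x = 0 := by linear_combination δ * h1 - β * h2
    have hy : (α * δ - β * γ) * σ y = 0 := by linear_combination α * h2 - γ * h1
    simp only [mul_eq_zero, hdet, false_or, EmbeddingLike.map_eq_zero_iff] at hx hy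
    rw [hx, hy]; rfl
  have hfg : ∀ x, M (x, f x) = (α * σ x + β * σ (f x), g (α * σ x + β * σ (f x))) := fun x => by
    rw [h]; rfl
  refine ⟨σ, AddEquiv.ofBijective M (Finite.injective_iff_bijective.1 hM), fun c w => ?_, ?_⟩
  · ext <;> simp [M] <;> ring
  · have hinj : Function.Injective fun x => α * σ x + β * σ (f x) := fun x y hxy => by
      have := hM ((hfg x).trans (Eq.trans (by simp only at hxy; rw [hxy]) (hfg y).symm))
      exact congrArg Prod.fst this
    ext ⟨x, y⟩
    simp only [Set.mem_image, SetLike.mem_coe, LinearMap.mem_graph_iff, AddEquiv.ofBijective_apply]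
    constructor
    · rintro ⟨⟨x', y'⟩, hy', hM'⟩
      simp only at hy'
      subst hy'
      rw [hfg] at hM'
      obtain ⟨rfl, rfl⟩ := Prod.ext_iff.1 hM'
      rfl
    · rintro rfl
      obtain ⟨x', rfl⟩ := Finite.surjective_of_injective hinj x
      exact ⟨(x', f x'), rfl, hfg x'⟩

/-- The relations say c(yx) = y·b(x), so multiplication by y carries the graph of b onto that of c.
-/
theorem sameGammaLOrbit_graph_of_scalar [Finite K] (b c : Fin 4 → K) {y : K} (hy : y ≠ 0)
    (h0 : b 0 * y = c 0 * y) (h1 : b 1 * y = c 1 * φ y) (h2 : b 2 * y = c 2 * φ (φ y))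
    (h3 : b 3 * y = c 3 * φ (φ (φ y))) :
    SameGammaLOrbit K (qPolynomial F c).graph (qPolynomial F b).graph := by
  refine SameGammaLOrbit.symm (sameGammaLOrbit_graph (RingEquiv.refl K) y 0 0 y (by simp [hy])
    fun x => ?_)
  simp only [qPolynomial_four_apply, RingEquiv.refl_apply, zero_mul, add_zero, zero_add, map_mul]
  linear_combination -x * h0 - φ x * h1 - φ (φ x) * h2 - φ (φ (φ x)) * h3

/-- If `a₁` and `a₃` have the same norm, then the graphs of the `q`-polynomial and of its adjoint are
equivalent under a semilinear map with companion automorphism `x ↦ x^(q^2)`. -/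
theorem sameGammaLOrbit_adjoint_of_norm_eq [Fintype K] (hK : Fintype.card K = Fintype.card F ^ 4)
    (a : Fin 4 → K) (hN : a 1 * φ (a 1) * φ (φ (a 1)) * φ (φ (φ (a 1))) =
      a 3 * φ (a 3) * φ (φ (a 3)) * φ (φ (φ (a 3)))) :
    SameGammaLOrbit K (qPolynomial F a).graph (qPolynomial F (adjointCoeff F a)).graph := by
  have h4 := frobenius_four (F := F) hK
  have hα : ∃ α, α ≠ 0 ∧ a 3 * α = φ (a 1) * φ α := by
    by_cases ha : a 1 = 0
    · have ha3 : a 3 = 0 := by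
        by_contra h
        simp [ha, h] at hN
      exact ⟨1, one_ne_zero, by simp [ha, ha3]⟩
    · have ha3 : a 3 ≠ 0 := fun h => by simp [ha, h] at hN
      obtain ⟨α, hα, h⟩ := exists_frobenius_eq_mul (F := F) hK (x := a 3 / φ (a 1)) (by
        simp only [map_div₀, div_mul_div_comm, h4]
        rw [← hN, ← div_self (a := a 1 * φ (a 1) * φ (φ (a 1)) * φ (φ (φ (a 1)))) (by simp [ha])]
        ring)
      have : φ (a 1) ≠ 0 := by simpa using ha
      exact ⟨α, hα, by rw [h]; field_simp⟩
  obtain ⟨α, hα0, hα⟩ := hα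
  let σ : K ≃+* K :=
    { toFun := fun x => φ (φ x)
      invFun := fun x => φ (φ x)
      left_inv := fun x => h4 x
      right_inv := fun x => h4 x
      map_mul' := fun x y => by simp only [map_mul]
      map_add' := fun x y => by simp only [map_add] }
  have hσ : ∀ x, σ x = φ (φ x) := fun _ => rfl
  -- The lower-left entry corrects the coefficient of φ²(x). The equation for α matches those of
  -- φ(x) and φ³(x), and that of x agrees by itself.
  refine sameGammaLOrbit_graph σ α 0 (a 0 * α - φ (φ α) * φ (φ (a 0))) (φ (φ α)) (by simp [hα0])
    fun x => ?_
  have e1 := congrArg φ hα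
  have e2 := congrArg φ e1
  simp only [map_mul] at e1 e2
  simp only [hσ, qPolynomial_four_apply, map_add, map_mul, h4, zero_mul, add_zero, adjointCoeff,
    Matrix.cons_val]
  linear_combination φ (φ (φ x)) * e1 - φ x * e2

/-! ### Linear maps as q-polynomials, and the trace form -/

/-- Multiplying by three distinct monomials in `sum_units_prod_frobenius` isolates the remaining
coefficient. -/
theorem qPolynomial_injective [Fintype K] (hK : Fintype.card K = Fintype.card F ^ 4) :
    Function.Injective (qPolynomial F : (Fin 4 → K) → K →ₗ[F] K) := by
  classical
  intro a b hab
  have h : ∀ x : Kˣ, (a - b) 0 * (x : K) + (a - b) 1 * φ x + (a - b) 2 * φ (φ x) +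
      (a - b) 3 * φ (φ (φ x)) = 0 := fun x => by
    have := LinearMap.congr_fun hab x
    rw [qPolynomial_four_apply, qPolynomial_four_apply] at this
    simp only [Pi.sub_apply]
    linear_combination this
  have e0 : (a - b) 0 = 0 := by
    have := sum_units_prod_frobenius (F := F) hK (a - b) ![0, 1, 0, 0] ![0, 0, 1, 0] ![0, 0, 0, 1]
    simpa only [h, zero_mul, mul_zero, zero_div, Finset.sum_const_zero, Matrix.cons_val, add_zero,
      zero_add, mul_one, one_mul, eq_comm (a := (0 : K)), neg_eq_zero] using this
  have e1 : (a - b) 1 = 0 := by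
    have := sum_units_prod_frobenius (F := F) hK ![1, 0, 0, 0] (a - b) ![0, 0, 1, 0] ![0, 0, 0, 1]
    simpa only [h, zero_mul, mul_zero, zero_div, Finset.sum_const_zero, Matrix.cons_val, add_zero,
      zero_add, mul_one, one_mul, eq_comm (a := (0 : K)), neg_eq_zero] using this
  have e2 : (a - b) 2 = 0 := by
    have := sum_units_prod_frobenius (F := F) hK ![1, 0, 0, 0] ![0, 1, 0, 0] (a - b) ![0, 0, 0, 1]
    simpa only [h, zero_mul, mul_zero, zero_div, Finset.sum_const_zero, Matrix.cons_val, add_zero,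
      zero_add, mul_one, one_mul, eq_comm (a := (0 : K)), neg_eq_zero] using this
  have e3 : (a - b) 3 = 0 := by
    have := sum_units_prod_frobenius (F := F) hK ![1, 0, 0, 0] ![0, 1, 0, 0] ![0, 0, 1, 0] (a - b)
    simpa only [h, zero_mul, mul_zero, zero_div, Finset.sum_const_zero, Matrix.cons_val, add_zero,
      zero_add, mul_one, one_mul, eq_comm (a := (0 : K)), neg_eq_zero] using this
  rw [← sub_eq_zero]
  funext i
  fin_cases i
  exacts [e0, e1, e2, e3]

theorem qPolynomial_surjective (hK : Module.finrank F K = 4) :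
    Function.Surjective (qPolynomial F : (Fin 4 → K) → K →ₗ[F] K) := by
  have : Module.Finite F K := Module.finite_of_finrank_pos (by omega)
  have : Finite K := Module.finite_of_finite F
  have := Fintype.ofFinite K
  have : Finite (K →ₗ[F] K) := Module.finite_of_finite F
  have hcard : Fintype.card K = Fintype.card F ^ 4 := by rw [Module.card_eq_pow_finrank (K := F), hK]
  refine (Function.Injective.bijective_of_nat_card_le (qPolynomial_injective hcard) ?_).2
  rw [Module.natCard_eq_pow_finrank (K := F), Module.finrank_linearMap, hK, Nat.card_fun,
    Nat.card_eq_fintype_card, Nat.card_eq_fintype_card, Nat.card_eq_fintype_card, hcard,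
    Fintype.card_fin, ← pow_mul]

theorem trace_frobenius [Finite K] (x : K) : Algebra.trace F K (φ x) = Algebra.trace F K x :=
  have : Module.Finite F K := Module.Finite.of_finite
  Algebra.trace_eq_of_algEquiv (FiniteField.frobeniusAlgEquivOfAlgebraic F K) x

theorem eq_zero_of_trace_mul_eq_zero [Finite K] {x : K}
    (h : ∀ y, Algebra.trace F K (y * x) = 0) : x = 0 :=
  have : Module.Finite F K := Module.Finite.of_finite
  (traceForm_nondegenerate F K).1 x fun y => by rw [Algebra.traceForm_apply, mul_comm]; exact h y

theorem trace_mul_qPolynomial [Fintype K] (hK : Fintype.card K = Fintype.card F ^ 4)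
    (a : Fin 4 → K) (x y : K) : Algebra.trace F K (x * qPolynomial F (adjointCoeff F a) y) =
      Algebra.trace F K (qPolynomial F a x * y) := by
  have h4 := frobenius_four (F := F) hK
  have t1 : Algebra.trace F K (x * (φ (a 3) * φ y)) =
      Algebra.trace F K (a 3 * φ (φ (φ x)) * y) := by
    rw [← trace_frobenius (a 3 * _ * _)]
    simp only [map_mul, h4]; ring_nf
  have t2 : Algebra.trace F K (x * (φ (φ (a 2)) * φ (φ y))) =
      Algebra.trace F K (a 2 * φ (φ x) * y) := by
    rw [← trace_frobenius (a 2 * _ * _), ← trace_frobenius (φ (a 2 * _ * _))]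
    simp only [map_mul, h4]; ring_nf
  have t3 : Algebra.trace F K (x * (φ (φ (φ (a 1))) * φ (φ (φ y)))) =
      Algebra.trace F K (a 1 * φ x * y) := by
    rw [← trace_frobenius (x * _)]
    simp only [map_mul, h4]; ring_nf
  simp only [qPolynomial_four_apply, adjointCoeff, Matrix.cons_val, mul_add, add_mul, map_add, t1, t2,
    t3]
  rw [show x * (a 0 * y) = a 0 * x * y by ring]
  ring

/-! ### Equivalence of a graph with the graph of the adjoint -/

/-- The bilinear form `Tr(a x y + b (x f(y) + f(x) y) + d f(x) f(y))` on `K`, where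
`h = (a, b, d)`. -/
noncomputable def symmTraceForm {F K : Type*} [Field F] [Field K] [Algebra F K] (f : K →ₗ[F] K)
    (h : K × K × K) : LinearMap.BilinForm F K :=
  LinearMap.mk₂ F (fun x y => Algebra.trace F K
      (h.1 * x * y + h.2.1 * (x * f y + f x * y) + h.2.2 * f x * f y))
    (fun x x' y => by rw [← map_add]; congr 1; rw [map_add]; ring)
    (fun c x y => by
      refine Eq.trans (congrArg _ ?_) (map_smul (Algebra.trace F K) c _)
      simp only [map_smul]
      simp only [Algebra.smul_def]
      ring)
    (fun x y y' => by rw [← map_add]; congr 1; rw [map_add]; ring)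
    (fun c x y => by
      refine Eq.trans (congrArg _ ?_) (map_smul (Algebra.trace F K) c _)
      simp only [map_smul]
      simp only [Algebra.smul_def]
      ring)

theorem symmTraceForm_apply {F K : Type*} [Field F] [Field K] [Algebra F K] (f : K →ₗ[F] K)
    (h : K × K × K) (x y : K) :
    symmTraceForm f h x y = Algebra.trace F K
      (h.1 * x * y + h.2.1 * (x * f y + f x * y) + h.2.2 * f x * f y) := rfl

theorem symmTraceForm_add {F K : Type*} [Field F] [Field K] [Algebra F K] (f : K →ₗ[F] K)
    (h h' : K × K × K) :
    symmTraceForm f (h + h') = symmTraceForm f h + symmTraceForm f h' := by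
  ext x y
  simp only [LinearMap.add_apply, symmTraceForm_apply, ← map_add, Prod.fst_add, Prod.snd_add]
  ring_nf

/-- Symmetric bilinear forms on `K` form a space of dimension `10`, and the triples `(a, b, d)` one of
dimension `12`. -/
theorem exists_symmTraceForm_eq_zero {F K : Type*} [Field F] [Field K] [Algebra F K]
    (hK : Module.finrank F K = 4) (f : K →ₗ[F] K) :
    ∃ h h' : K × K × K, h ≠ 0 ∧ (∀ c : F, c • h ≠ h') ∧ symmTraceForm f h = 0 ∧
      symmTraceForm f h' = 0 := by
  have hfin : Module.Finite F K := Module.finite_of_finrank_pos (by omega)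
  let v : Module.Basis (Fin 4) F K := Module.finBasisOfFinrankEq F K hK
  let Φ : K × K × K →ₗ[F] ({p : Fin 4 × Fin 4 // p.1 ≤ p.2} → F) :=
    { toFun := fun h p => symmTraceForm f h (v p.1.1) (v p.1.2)
      map_add' := fun h h' => by ext p; rw [symmTraceForm_add]; rfl
      map_smul' := fun c h => by
        ext p
        simp only [symmTraceForm_apply, Pi.smul_apply, RingHom.id_apply, ← map_smul]
        congr 1
        simp only [Prod.smul_fst, Prod.smul_snd]
        simp only [Algebra.smul_def]
        ring }
  have hker : ∀ h ∈ LinearMap.ker Φ, symmTraceForm f h = 0 := fun h hh => by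
    have hle : ∀ i j, i ≤ j → symmTraceForm f h (v i) (v j) = 0 := fun i j hij =>
      congrFun (LinearMap.mem_ker.1 hh) ⟨(i, j), hij⟩
    refine LinearMap.BilinForm.ext_basis v fun i j => ?_
    rcases le_total i j with hij | hij
    · exact hle i j hij
    · refine Eq.trans ?_ (hle j i hij)
      rw [symmTraceForm_apply, symmTraceForm_apply]
      ring_nf
  have hdim := LinearMap.finrank_range_add_finrank_ker Φ
  have hr := Submodule.finrank_le (LinearMap.range Φ)
  rw [Module.finrank_fintype_fun_eq_card,
    show Fintype.card {p : Fin 4 × Fin 4 // p.1 ≤ p.2} = 10 from rfl] at hr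
  rw [Module.finrank_prod, Module.finrank_prod, hK] at hdim
  by_contra! hcon
  have : 0 < Module.finrank F (LinearMap.ker Φ) := by omega
  have := Module.finrank_pos_iff.1 this
  obtain ⟨h, hh⟩ := exists_ne (0 : LinearMap.ker Φ)
  have := finrank_le_one h fun h' => by_contra fun hc =>
    hcon h h' (by simpa using hh) (fun c hc' => hc ⟨c, Subtype.ext hc'⟩) (hker _ h.2) (hker _ h'.2)
  omega

/-- φ permutes the roots k and n - k of a quadratic over F. -/
theorem frobenius_frobenius_of_quadratic {k : K} {m n : F}
    (h : k * k = algebraMap F K m + algebraMap F K n * k) : φ (φ k) = k := by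
  have h' := congrArg φ h
  simp only [map_mul, map_add, AlgHom.commutes] at h'
  have : (φ k - k) * (φ k + k - algebraMap F K n) = 0 := by linear_combination h' - h
  rcases mul_eq_zero.1 this with h1 | h1
  · have : φ k = k := sub_eq_zero.1 h1
    rw [this, this]
  · have h2 : φ k = algebraMap F K n - k := by linear_combination h1
    rw [h2, map_sub, AlgHom.commutes, h2]
    ring

/-- A subspace that is totally isotropic for the forms `Tr(d x y)` and `Tr(k d x y)`, where `k` is not
in `F`, is contained in a multiple of the quadratic extension of `F`. -/
theorem exists_mem_quadratic_of_isotropic [Fintype K] (hK : Module.finrank F K = 4)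
    (A : Submodule F K) {d k : K} (hd : d ≠ 0) (hk : ∀ c : F, algebraMap F K c ≠ k)
    (h : ∀ x ∈ A, ∀ y ∈ A, Algebra.trace F K (d * x * y) = 0)
    (h' : ∀ x ∈ A, ∀ y ∈ A, Algebra.trace F K (k * d * x * y) = 0) :
    ∃ μ : K, μ ≠ 0 ∧ ∀ x ∈ A, φ (φ x) * μ = x * φ (φ μ) := by
  have hfin : Module.Finite F K := Module.Finite.of_finite
  by_cases hA : A = ⊥
  · exact ⟨1, one_ne_zero, fun x hx => by simp [(Submodule.mem_bot F).1 (hA ▸ hx)]⟩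
  obtain ⟨α, hα, hα0⟩ := Submodule.exists_mem_ne_zero_of_ne_bot hA
  refine ⟨α, hα0, ?_⟩
  have hk0 : k ≠ 0 := fun h0 => hk 0 (by rw [map_zero, h0])
  set P := (Algebra.traceForm F K).orthogonal A with hP
  have hPdim : Module.finrank F P = 4 - Module.finrank F A := by
    rw [hP, LinearMap.BilinForm.finrank_orthogonal (traceForm_nondegenerate F K), hK]
  have hmul : ∀ e : K, e ≠ 0 → (∀ x ∈ A, ∀ y ∈ A, Algebra.trace F K (e * x * y) = 0) →
      A.map (LinearMap.mulLeft F e) ≤ P ∧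
        Module.finrank F (A.map (LinearMap.mulLeft F e)) = Module.finrank F A := by
    intro e he hh
    constructor
    · rintro _ ⟨x, hx, rfl⟩ y hy
      rw [Algebra.traceForm_apply, LinearMap.mulLeft_apply, mul_comm]
      exact hh x hx y hy
    · exact LinearEquiv.finrank_eq (Submodule.equivMapOfInjective _
        (mul_right_injective₀ he) A).symm
  obtain ⟨l1, r1⟩ := hmul d hd h
  obtain ⟨l2, r2⟩ := hmul (k * d) (mul_ne_zero hk0 hd) h'
  have hle := Submodule.finrank_mono l1
  have hA4 := Submodule.finrank_le A
  rw [hK] at hA4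
  have hpair : ∀ β ∈ A, k * α ∈ A → Module.finrank F A ≤ 2 →
      ∃ m n : F, β = algebraMap F K m * α + algebraMap F K n * (k * α) := by
    intro β hβ hkα h2
    have hli : LinearIndependent F ![α, k * α] := by
      rw [LinearIndependent.pair_iff' hα0]
      intro c hc
      apply hk c
      rw [Algebra.smul_def] at hc
      exact mul_right_cancel₀ hα0 hc
    have hs : Submodule.span F {α, k * α} = A := by
      apply Submodule.eq_of_le_of_finrank_le
      · rw [Submodule.span_le]
        rintro x (rfl | rfl)
        exacts [hα, hkα]
      · have hset : Set.range ![α, k * α] = {α, k * α} := by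
          simp [Matrix.range_cons, Matrix.range_empty, Set.pair_comm]
        rw [← hset, finrank_span_eq_card hli]
        exact h2
    rw [← hs] at hβ
    obtain ⟨m, n, hmn⟩ := Submodule.mem_span_pair.1 hβ
    exact ⟨m, n, by rw [← hmn, Algebra.smul_def, Algebra.smul_def]⟩
  by_cases h1 : Module.finrank F A ≤ 1
  · intro x hx
    have hs : Submodule.span F {α} = A := by
      apply Submodule.eq_of_le_of_finrank_le
      · simpa using hα
      · rwa [finrank_span_singleton hα0]
    rw [← hs] at hx
    obtain ⟨c, rfl⟩ := Submodule.mem_span_singleton.1 hx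
    rw [map_smul, map_smul, Algebra.smul_def, Algebra.smul_def]
    ring
  -- Both dA and kdA lie in the orthogonal space of A, of dimension 4 - dim A. As dim A ≥ 2, both
  -- fill it; hence kA ⊆ A, and A is spanned by α and kα.
  · have hP1 := Submodule.eq_of_le_of_finrank_le l1 (by omega)
    have hP2 := Submodule.eq_of_le_of_finrank_le l2 (by omega)
    have hkA : ∀ x ∈ A, k * x ∈ A := by
      intro x hx
      have hx' : k * d * x ∈ P := l2 ⟨x, hx, rfl⟩
      rw [← hP1] at hx'
      obtain ⟨y, hy, hxy⟩ := hx'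
      rw [LinearMap.mulLeft_apply] at hxy
      have : y = k * x := mul_left_cancel₀ hd (by rw [hxy]; ring)
      exact this ▸ hy
    obtain ⟨m, n, hmn⟩ := hpair _ (hkA _ (hkA _ hα)) (hkA _ hα) (by omega)
    have hkk : φ (φ k) = k := frobenius_frobenius_of_quadratic (m := m) (n := n) (by
      apply mul_right_cancel₀ hα0
      linear_combination hmn)
    intro x hx
    obtain ⟨m, n, rfl⟩ := hpair x hx (hkA _ hα) (by omega)
    simp only [map_add, map_mul, AlgHom.commutes, hkk]
    ring

/-- If some translate `f + s x` has image in a multiple of the quadratic extension of `F`, then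
`a₁` and `a₃` have the same norm. -/
theorem norm_eq_of_range_le [Fintype K] (hK : Fintype.card K = Fintype.card F ^ 4)
    (a : Fin 4 → K) {s μ : K} (hμ : μ ≠ 0)
    (h : ∀ x, φ (φ (qPolynomial F a x + s * x)) * μ = (qPolynomial F a x + s * x) * φ (φ μ)) :
    a 1 * φ (a 1) * φ (φ (a 1)) * φ (φ (φ (a 1))) =
      a 3 * φ (a 3) * φ (φ (a 3)) * φ (φ (φ (a 3))) := by
  have h4 := frobenius_four (F := F) hK
  have hc : qPolynomial F ![φ (φ (a 2)) * μ, φ (φ (a 3)) * μ, φ (φ (a 0 + s)) * μ, φ (φ (a 1)) * μ] =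
      qPolynomial F ![(a 0 + s) * φ (φ μ), a 1 * φ (φ μ), a 2 * φ (φ μ), a 3 * φ (φ μ)] := by
    ext x
    have := h x
    simp only [qPolynomial_four_apply, map_add, map_mul, h4, Matrix.cons_val] at this ⊢
    linear_combination this
  -- The coefficient of x^q does not involve s. Taking norms cancels μ, which has the same norm as
  -- φ²(μ).
  have h1 : φ (φ (a 3)) * μ = a 1 * φ (φ μ) := congrFun (qPolynomial_injective hK hc) 1
  have h2 := congrArg φ h1
  have h3 := congrArg φ h2
  have h5 := congrArg φ h3
  simp only [map_mul, h4] at h2 h3 h5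
  have hne : μ * φ μ * φ (φ μ) * φ (φ (φ μ)) ≠ 0 := by simp [hμ]
  apply mul_right_cancel₀ hne
  calc _ = (a 1 * φ (φ μ)) * (φ (a 1) * φ (φ (φ μ))) * (φ (φ (a 1)) * μ) *
        (φ (φ (φ (a 1))) * φ μ) := by ring
    _ = _ := by rw [← h1, ← h2, ← h3, ← h5]; ring

/-- Moving f to the other side of the trace turns the vanishing form, with h = (p, b, d), into
Tr(x·(py + bf(y) + g(by + df(y)))) = 0 for all x, where g is the adjoint. Nondegeneracy gives g(by +
df(y)) = -py - bf(y), and the resulting matrix has determinant pd - b². -/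
theorem sameGammaLOrbit_adjoint_of_symmTraceForm [Fintype K]
    (hK : Fintype.card K = Fintype.card F ^ 4) (a : Fin 4 → K) {h : K × K × K}
    (hh : symmTraceForm (qPolynomial F a) h = 0) (hdet : h.1 * h.2.2 ≠ h.2.1 * h.2.1) :
    SameGammaLOrbit K (qPolynomial F a).graph (qPolynomial F (adjointCoeff F a)).graph := by
  refine sameGammaLOrbit_graph (RingEquiv.refl K) h.2.1 h.2.2 (-h.1) (-h.2.1)
    (fun h0 => hdet (by linear_combination h0)) fun y => ?_
  rw [← sub_eq_zero]
  refine eq_zero_of_trace_mul_eq_zero (F := F) fun x => ?_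
  have := LinearMap.congr_fun (LinearMap.congr_fun hh x) y
  rw [symmTraceForm_apply] at this
  simp only [RingEquiv.refl_apply]
  rw [mul_sub, map_sub, trace_mul_qPolynomial hK, ← map_sub]
  refine Eq.trans ?_ this
  ring_nf

theorem sameGammaLOrbit_adjoint [Fintype K] (hK : Module.finrank F K = 4) (a : Fin 4 → K) :
    SameGammaLOrbit K (qPolynomial F a).graph (qPolynomial F (adjointCoeff F a)).graph := by
  have hcard : Fintype.card K = Fintype.card F ^ 4 := by rw [Module.card_eq_pow_finrank (K := F), hK]
  by_contra hno
  have hdeg : ∀ h, symmTraceForm (qPolynomial F a) h = 0 → h.1 * h.2.2 = h.2.1 * h.2.1 := fun h hh =>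
    by_contra fun hne => hno (sameGammaLOrbit_adjoint_of_symmTraceForm hcard a hh hne)
  have hd0 : ∀ h, symmTraceForm (qPolynomial F a) h = 0 → h.2.2 = 0 → h = 0 := by
    rintro ⟨p, b, d⟩ hh hd
    have hb := hdeg _ hh
    simp only at hd hb
    subst hd
    have hb : b = 0 := by simpa [eq_comm] using hb
    subst hb
    have : p = 0 := eq_zero_of_trace_mul_eq_zero (F := F) fun y => by
      have := LinearMap.congr_fun (LinearMap.congr_fun hh y) 1
      rw [symmTraceForm_apply] at this
      simpa [mul_comm] using this
    simp [this]
  obtain ⟨h, h', hne, hind, hh, hh'⟩ := exists_symmTraceForm_eq_zero hK (qPolynomial F a)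
  have hsum := hdeg _ (by rw [symmTraceForm_add, hh, hh', add_zero] : symmTraceForm _ (h + h') = 0)
  have e := hdeg _ hh
  have e' := hdeg _ hh'
  have hd : h.2.2 ≠ 0 := fun h0 => hne (hd0 _ hh h0)
  have hd' : h'.2.2 ≠ 0 := fun h0 => hind 0 (by rw [zero_smul, hd0 _ hh' h0])
  obtain ⟨p, b, d⟩ := h
  obtain ⟨p', b', d'⟩ := h'
  simp only [Prod.fst_add, Prod.snd_add] at hsum e e' hd hd'
  -- Degeneracy of h, h' and h + h' polarises to pd' + p'd = 2bb', which makes (b'd - bd')² vanish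
  -- in every characteristic.
  have hb : b' * d = b * d' := by
    have : (b' * d - b * d') ^ 2 = 0 := by
      linear_combination d * d' * (hsum - e - e') - d' ^ 2 * e - d ^ 2 * e'
    exact sub_eq_zero.1 (pow_eq_zero_iff two_ne_zero |>.1 this)
  -- Since p = b²/d, the form is the pullback of Tr(dxy) along x ↦ f(x) + (b/d)x. The second triple
  -- has the same b/d.
  have hform : ∀ x y : K, Algebra.trace F K
      (d * (qPolynomial F a x + b / d * x) * (qPolynomial F a y + b / d * y)) = 0 := fun x y => by
    have := LinearMap.congr_fun (LinearMap.congr_fun hh x) y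
    rw [symmTraceForm_apply] at this
    refine Eq.trans (congrArg _ ?_) this
    simp only
    field_simp
    linear_combination -x * y * e
  have hform' : ∀ x y : K, Algebra.trace F K (d' / d * d * (qPolynomial F a x + b / d * x) *
      (qPolynomial F a y + b / d * y)) = 0 := fun x y => by
    have := LinearMap.congr_fun (LinearMap.congr_fun hh' x) y
    rw [symmTraceForm_apply] at this
    refine Eq.trans (congrArg _ ?_) this
    have hbd : b / d = b' / d' := by field_simp; linear_combination -hb
    rw [hbd]
    simp only
    field_simp
    linear_combination -x * y * e'
  let u : K →ₗ[F] K := qPolynomial F a + LinearMap.mulLeft F (b / d)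
  obtain ⟨μ, hμ, hA⟩ := exists_mem_quadratic_of_isotropic hK (LinearMap.range u) (d := d)
    (k := d' / d) hd
    -- If d'/d were in F, the equal ratios b/d and degeneracy would make the whole triple h' an
    -- F-multiple of h.
    (fun c hc => hind c (by
      have hd1 : d' = algebraMap F K c * d := by rw [hc]; field_simp
      have hb1 : b' = algebraMap F K c * b := by
        apply mul_right_cancel₀ hd
        rw [hb, hd1]; ring
      have hp1 : p' = algebraMap F K c * p := by
        apply mul_right_cancel₀ hd'
        rw [e', hb1, hd1]
        linear_combination -(algebraMap F K c) ^ 2 * e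
      rw [Prod.smul_mk, Prod.smul_mk, Algebra.smul_def, Algebra.smul_def, Algebra.smul_def,
        hd1, hb1, hp1]))
    (by rintro _ ⟨x, rfl⟩ _ ⟨y, rfl⟩; exact hform x y)
    (by rintro _ ⟨x, rfl⟩ _ ⟨y, rfl⟩; exact hform' x y)
  exact hno (sameGammaLOrbit_adjoint_of_norm_eq hcard a
    (norm_eq_of_range_le hcard a (s := b / d) hμ fun x => hA _ ⟨x, rfl⟩))

theorem sameGammaLOrbit_of_slopes_eq [Fintype K] (hK : Module.finrank F K = 4) (a b : Fin 4 → K)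
    (h : ∀ z : K, (∃ x : Kˣ, qPolynomial F a x / x = z) ↔ ∃ x : Kˣ, qPolynomial F b x / x = z) :
    SameGammaLOrbit K (qPolynomial F a).graph (qPolynomial F b).graph := by
  classical
  have hcard : Fintype.card K = Fintype.card F ^ 4 := by rw [Module.card_eq_pow_finrank (K := F), hK]
  obtain ⟨h0, h1, h2, h3, h4⟩ := coeff_relations hcard a b fun G => by
    rw [sum_units_div, sum_units_div]
    simp only [h]
  obtain ⟨c, hc, y, hy, e0, e1, e2, e3⟩ :=
    exists_scalar_of_coeff_relations hcard a b h0 h1 h2 h3 h4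
  have hcb := sameGammaLOrbit_graph_of_scalar b c hy e0 e1 e2 e3
  rcases hc with rfl | rfl
  · exact hcb
  · exact (sameGammaLOrbit_adjoint hK a).trans hcb

/-! ### From linear sets to slopes -/

theorem exists_notMem_linearSet {W : Type*} [AddCommGroup W] [Module F W] [Module K W]
    (hK : Module.finrank F K = 4) (hW : Module.finrank K W = 2) (U : Submodule F W)
    (hU : Module.finrank F U = 4) : ∃ P : ℙ K W, P ∉ linearSet U := by
  classical
  by_contra! hall
  have : Module.Finite F K := Module.finite_of_finrank_pos (by omega)
  have : Finite K := Module.finite_of_finite F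
  have : Module.Finite F U := Module.finite_of_finrank_pos (by omega)
  have : Finite U := Module.finite_of_finite F
  have : Nontrivial W := Module.nontrivial_of_finrank_pos (R := K) (by omega)
  -- Sending 0 to an arbitrary point does no harm: q⁴ vectors still cannot cover q⁴ + 1 points.
  let m : U → ℙ K W := fun u =>
    if hu : (u : W) ≠ 0 then Projectivization.mk K (u : W) hu else Classical.arbitrary _
  have hm : Function.Surjective m := fun P => by
    obtain ⟨u, hu, huU, rfl⟩ := hall P
    exact ⟨⟨u, huU⟩, by simp [m, hu]⟩
  have := Nat.card_le_card_of_surjective m hm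
  rw [Projectivization.card_of_finrank_two K W hW, Module.natCard_eq_pow_finrank (K := F) (V := K),
    Module.natCard_eq_pow_finrank (K := F) (V := U), hK, hU] at this
  omega

theorem exists_linearEquiv_prod {W : Type*} [AddCommGroup W] [Module K W]
    (hW : Module.finrank K W = 2) {v : W} (hv : v ≠ 0) : ∃ e : W ≃ₗ[K] K × K, e v = (0, 1) := by
  have hfin : Module.Finite K W := Module.finite_of_finrank_pos (by omega)
  obtain ⟨w, hw⟩ : ∃ w, w ∉ Submodule.span K {v} := by
    by_contra! hall
    have h1 := finrank_span_singleton (K := K) hv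
    rw [(Submodule.eq_top_iff'.2 hall : Submodule.span K {v} = ⊤), finrank_top] at h1
    omega
  have hli : LinearIndependent K ![w, v] := by
    refine LinearIndependent.pair_symm_iff.1 ((LinearIndependent.pair_iff' hv).2 fun c hc => hw ?_)
    exact hc ▸ Submodule.smul_mem _ c (Submodule.mem_span_singleton_self v)
  let b := basisOfLinearIndependentOfCardEqFinrank hli (by simp [hW])
  refine ⟨b.equivFun.trans (LinearEquiv.finTwoArrow K K), ?_⟩
  have hb : b 1 = v := by simp [b]
  rw [← hb]
  simp

/-- In suitable coordinates, all `F`-subspaces of rank four that define a linear set missing the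
point `P` are graphs of `q`-polynomials. -/
theorem exists_qPolynomial_graph {W : Type*} [AddCommGroup W] [Module F W] [Module K W]
    [IsScalarTower F K W] (hK : Module.finrank F K = 4) {v : W} (hv : v ≠ 0) (e : W ≃ₗ[K] K × K)
    (he : e v = (0, 1)) (V : Submodule F W) (hV : Module.finrank F V = 4)
    (hvV : Projectivization.mk K v hv ∉ linearSet V) :
    ∃ a : Fin 4 → K, ∀ w, e w ∈ (qPolynomial F a).graph ↔ w ∈ V := by
  have : Module.Finite F K := Module.finite_of_finrank_pos (by omega)
  have : Module.Finite F V := Module.finite_of_finrank_pos (by omega)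
  let e' : W ≃ₗ[F] K × K := e.restrictScalars F
  let V' : Submodule F (K × K) := V.map (e' : W →ₗ[F] K × K)
  have hV' : Module.finrank F V' = 4 := by
    rw [← hV]; exact LinearEquiv.finrank_map_eq e' V
  have hmem : ∀ w, e w ∈ V' ↔ w ∈ V := fun w => by
    constructor
    · rintro ⟨w', hw', h⟩
      exact e.injective h ▸ hw'
    · exact fun hw => ⟨w, hw, rfl⟩
  -- A nonzero vector (0, y) in the image would put the missed point in the linear set.
  have hinj : Function.Injective ((LinearMap.fst F K K).comp V'.subtype) := by
    rw [injective_iff_map_eq_zero]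
    rintro ⟨⟨x, y⟩, hxy⟩ hx
    obtain rfl : x = 0 := hx
    by_contra hne
    have hy : y ≠ 0 := fun h0 => hne (by subst h0; rfl)
    have hyv : e (y • v) = (0, y) := by rw [map_smul, he]; simp
    refine hvV ⟨y • v, smul_ne_zero hy hv, (hmem _).1 (by rw [hyv]; exact hxy), ?_⟩
    rw [Projectivization.mk_eq_mk_iff']
    exact ⟨y⁻¹, by rw [smul_smul, inv_mul_cancel₀ hy, one_smul]⟩
  have hbij : Function.Bijective (Prod.fst ∘ V'.subtype) :=
    ⟨hinj, (LinearMap.injective_iff_surjective_of_finrank_eq_finrank (by rw [hV', hK])).1 hinj⟩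
  obtain ⟨f, hf⟩ := Submodule.exists_eq_graph hbij
  obtain ⟨a, rfl⟩ := qPolynomial_surjective hK f
  exact ⟨a, fun w => by rw [← hf, hmem]⟩

theorem mem_linearSet_iff_slope {F K W : Type*} [Field F] [Field K] [Algebra F K]
    [AddCommGroup W] [Module F W] [Module K W]
    (e : W ≃ₗ[K] K × K) {V : Submodule F W} {f : K →ₗ[F] K} (hf : ∀ w, e w ∈ f.graph ↔ w ∈ V)
    (z : K) (hz : e.symm (1, z) ≠ 0) :
    Projectivization.mk K (e.symm (1, z)) hz ∈ linearSet V ↔ ∃ x : Kˣ, f x / x = z := by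
  constructor
  · rintro ⟨u, hu, huV, h⟩
    obtain ⟨c, hc⟩ := (Projectivization.mk_eq_mk_iff' K _ _ _ _).1 h
    have hc' : c • e u = (1, z) := by rw [← map_smul, hc, LinearEquiv.apply_symm_apply]
    have hfu := (LinearMap.mem_graph_iff _ _).1 ((hf u).2 huV)
    obtain ⟨h1, h2⟩ := Prod.ext_iff.1 hc'
    simp only [Prod.smul_fst, Prod.smul_snd, smul_eq_mul] at h1 h2
    have hne : (e u).1 ≠ 0 := right_ne_zero_of_mul_eq_one h1
    refine ⟨Units.mk0 _ hne, ?_⟩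
    rw [Units.val_mk0, ← hfu, div_eq_iff hne, ← h2]
    linear_combination -(e u).2 * h1
  · rintro ⟨x, rfl⟩
    have hx : e.symm ((x : K), f x) ≠ 0 := by
      simp
    refine ⟨e.symm ((x : K), f x), hx, (hf _).1 (by simp), ?_⟩
    rw [Projectivization.mk_eq_mk_iff']
    refine ⟨(x : K)⁻¹, ?_⟩
    rw [← map_smul]
    congr 1
    ext <;> simp [div_eq_inv_mul]

end LinearSetsOfRankFour

theorem theorem4p4 {F K : Type*} [Field F] [Fintype F] [Field K] [Algebra F K]
    (hK : Module.finrank F K = 4) :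
    (∀ {W : Type*} [AddCommGroup W] [Module F W] [Module K W] [IsScalarTower F K W],
      Module.finrank K W = 2 →
      ∀ U : Submodule F W, Module.finrank F U = 4 →
        HasMaxLinearityDegree F (linearSet U : Set (ℙ K W)) 1 →
        IsSimpleLinearSet K U) ∧
    (∀ a : Fin 4 → K,
      HasMaxLinearityDegree F
        (linearSet (qPolynomial F a).graph : Set (ℙ K (K × K))) 1 →
      SameGammaLOrbit K (qPolynomial F a).graph (qAdjoint F a).graph) := by
  have : Module.Finite F K := Module.finite_of_finrank_pos (by omega)
  have : Finite K := Module.finite_of_finite F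
  have := Fintype.ofFinite K
  refine ⟨?_, fun a _ => ?_⟩
  · intro W _ _ _ _ hW U hU hmax
    refine ⟨hmax, fun V hV hUV => ?_⟩
    -- One missed point serves U and V alike, so both become graphs in the same coordinates.
    obtain ⟨P, hP⟩ := exists_notMem_linearSet hK hW U hU
    obtain ⟨v, hv, rfl⟩ : ∃ v, ∃ hv : v ≠ 0, P = Projectivization.mk K v hv :=
      ⟨P.rep, P.rep_nonzero, P.mk_rep.symm⟩
    obtain ⟨e, he⟩ := exists_linearEquiv_prod hW hv
    obtain ⟨a, ha⟩ := exists_qPolynomial_graph hK hv e he U hU hP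
    obtain ⟨b, hb⟩ := exists_qPolynomial_graph hK hv e he V (hV ▸ hU) (hUV ▸ hP)
    refine SameGammaLOrbit.of_linearEquiv e ha hb (sameGammaLOrbit_of_slopes_eq hK a b fun z => ?_)
    have hz : e.symm (1, z) ≠ 0 := by simp
    rw [← mem_linearSet_iff_slope e ha z hz, ← mem_linearSet_iff_slope e hb z hz, hUV]
  · rw [qAdjoint_four (by rw [Module.card_eq_pow_finrank (K := F), hK])]
    exact sameGammaLOrbit_adjoint hK a
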